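/- Let $1\le m<n$. Let $(\overline M,H,G)$ be a smooth $4n$-dimensional manifold with an almost hypercomplex structure $H=(J_1,J_2,J_3)$, i.e. smooth endomorphism fields with $J_\alpha^2=-I$ and $J_\alpha=J_\beta J_\gamma=-J_\gamma J_\beta$ for all cyclic permutations $(\alpha,\beta,\gamma)$ of $(1,2,3)$, and with a pseudo-Riemannian metric $g$ such that $g(J_1X,J_1Y)=-g(J_2X,J_2Y)=-g(J_3X,J_3Y)=g(X,Y)$ (the remaining members of $G=(g,g_1,g_2,g_3)$ are $g_\alpha(X,Y)=g(J_\alpha X,Y)$). Let $\overline\nabla$ be the Levi-Civita connection of $g$, and put $\overline F_\alpha(X,Y,Z)=g((\overline\nabla_XJ_\alpha)Y,Z)$ and $\overline\theta_\alpha(Z)=g^{ij}\overline F_\alpha(e_i,e_j,Z)$, where $\{e_i\}$ is a basis of the tangent space and $(g^{ij})$ is the inverse of the matrix $(g(e_i,e_j))$. Assume that $(\overline M,H,G)$ is a $\mathcal W$-manifold: the Nijenhuis tensors of $J_1,J_2,J_3$ vanish, $$\overline F_1(X,Y,Z)=\tfrac{1}{2(2n-1)}\bigl[g(X,Y)\overline\theta_1(Z)-g(X,Z)\overline\theta_1(Y)-g(X,J_1Y)\overline\theta_1(J_1Z)+g(X,J_1Z)\overline\theta_1(J_1Y)\bigr],$$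 and for $\alpha=2,3$ $$\overline F_\alpha(X,Y,Z)=\tfrac{1}{4n}\bigl[g(X,Y)\overline\theta_\alpha(Z)+g(X,Z)\overline\theta_\alpha(Y)+g(X,J_\alpha Y)\overline\theta_\alpha(J_\alpha Z)+g(X,J_\alpha Z)\overline\theta_\alpha(J_\alpha Y)\bigr].$$ Let $M$ be a $4m$-dimensional (immersed) holomorphic submanifold of $\overline M$: $J_\alpha(T_pM)=T_pM$ for all $p\in M$ and $\alpha=1,2,3$, and the restriction of $g$ to $TM$ is non-degenerate. Let $TM^\bot$ be the normal bundle, let $h$ be the second fundamental form ($h(X,Y)$ is the normal component of $\overline\nabla_XY$ for vector fields $X,Y$ tangent to $M$), and let $C=\frac1{4m}\operatorname{trace}h$ be the mean curvature vector, the trace being taken with respect to the restriction of $g$ to $TM$. Call $M$ *totally geodesic* if $h=0$, and *totally umbilical* if $h(X,Y)=g(X,Y)\,C$ for all tangent $X,Y$ and $C$ is not identically zero. Then: 1. $h(X,Y)=g(X,Y)\,C$ for all $X,Y$ tangent to $M$ at a common point. 2. At every $p\in M$: $C_p\neq0$ if and only if each of $\overline\theta_1,\overline\theta_2,\overline\theta_3$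 is not identically zero on $T_pM^\bot$; and $C_p=0$ if and only if all of $\overline\theta_1,\overline\theta_2,\overline\theta_3$ vanish on $T_pM^\bot$. 3. $M$ is totally umbilical if and only if each of $\overline\theta_1,\overline\theta_2,\overline\theta_3$ is not identically zero on $TM^\bot$. 4. $M$ is totally geodesic if and only if all of $\overline\theta_1,\overline\theta_2,\overline\theta_3$ vanish identically on $TM^\bot$. -/

import Mathlib

open Bundle Module FiberBundle VectorField
open scoped Manifold ContDiff

noncomputable section

set_option linter.unusedSectionVars false

namespace HermitianNorden

instance {E M : Type*} [NormedAddCommGroup E] [NormedSpace ℝ E] [FiniteDimensional ℝ E]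
    [TopologicalSpace M] [ChartedSpace E M] (x : M) :
    FiniteDimensional ℝ (TangentSpace 𝓘(ℝ, E) x) :=
  inferInstanceAs (FiniteDimensional ℝ E)

/-- The trace `g^{ij} B(e_i, e_j)` of a bilinear map `B` with respect to a (non-degenerate) bilinear
form `g` on a finite-dimensional real space: `(e_i)` is a basis, `(g^{ij})` is the inverse of the
Gram matrix `(g(e_i, e_j))`. -/
def metricTrace {V W : Type*} [AddCommGroup V] [Module ℝ V] [FiniteDimensional ℝ V]
    [AddCommGroup W] [Module ℝ W] (g : V → V → ℝ) (B : V → V → W) : W :=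
  let e := Module.finBasis ℝ V
  ∑ i, ∑ j, (Matrix.of fun k l => g (e k) (e l))⁻¹ i j • B (e i) (e j)

section Ambient

variable {E : Type*} [NormedAddCommGroup E] [NormedSpace ℝ E] [FiniteDimensional ℝ E]
  (N : Type*) [TopologicalSpace N] [ChartedSpace E N] [IsManifold 𝓘(ℝ, E) ∞ N]

/-- An almost hypercomplex structure `H = (J₁, J₂, J₃)` on a manifold `N` together with a
pseudo-Riemannian metric `g` that is Hermitian for `J₁` and Norden for `J₂` and `J₃`.
The indices `1, 2, 3` are `0, 1, 2 : Fin 3`, and the cyclic permutations of `(1, 2, 3)` are the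
triples `(α, α + 1, α + 2)` modulo `3`. The remaining members of `G = (g, g₁, g₂, g₃)` are the forms
`g_α(X, Y) = g(J_α X, Y)`, determined by `g` and `H`. -/
structure AlmostHypercomplexHN where
  /-- The almost complex structures. -/
  J : Fin 3 → ∀ x : N, TangentSpace 𝓘(ℝ, E) x →L[ℝ] TangentSpace 𝓘(ℝ, E) x
  /-- The pseudo-Riemannian metric. -/
  g : ∀ x : N, TangentSpace 𝓘(ℝ, E) x →L[ℝ] TangentSpace 𝓘(ℝ, E) x →L[ℝ] ℝ
  contMDiff_J : ∀ α, ContMDiff 𝓘(ℝ, E) (𝓘(ℝ, E).prod 𝓘(ℝ, E →L[ℝ] E)) ∞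
    (fun x => TotalSpace.mk' (E →L[ℝ] E)
      (E := fun x : N => TangentSpace 𝓘(ℝ, E) x →L[ℝ] TangentSpace 𝓘(ℝ, E) x) x (J α x))
  contMDiff_g : ContMDiff 𝓘(ℝ, E) (𝓘(ℝ, E).prod 𝓘(ℝ, E →L[ℝ] E →L[ℝ] ℝ)) ∞
    (fun x => TotalSpace.mk' (E →L[ℝ] E →L[ℝ] ℝ)
      (E := fun x : N => TangentSpace 𝓘(ℝ, E) x →L[ℝ] TangentSpace 𝓘(ℝ, E) x →L[ℝ] ℝ) x (g x))
  J_sq : ∀ α x u, J α x (J α x u) = -u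
  J_cyclic : ∀ α x u, J α x u = J (α + 1) x (J (α + 2) x u)
  J_cyclic' : ∀ α x u, J α x u = -J (α + 2) x (J (α + 1) x u)
  g_symm : ∀ x u v, g x u v = g x v u
  g_nondeg : ∀ x u, (∀ v, g x u v = 0) → u = 0
  hermitian : ∀ x u v, g x (J 0 x u) (J 0 x v) = g x u v
  norden₂ : ∀ x u v, g x (J 1 x u) (J 1 x v) = -g x u v
  norden₃ : ∀ x u v, g x (J 2 x u) (J 2 x v) = -g x u v

variable {N}

namespace AlmostHypercomplexHN

variable (S : AlmostHypercomplexHN (E := E) N)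
  (cov : CovariantDerivative 𝓘(ℝ, E) E (TangentSpace 𝓘(ℝ, E) : N → Type _))

/-- `cov` is the Levi-Civita connection of `g`: it is torsion-free and metric.
(`cov Y x u` is `∇_u Y` at `x`.) -/
def IsLeviCivita : Prop :=
  cov.torsion = 0 ∧
  ∀ (x : N) (Y Z : ∀ y : N, TangentSpace 𝓘(ℝ, E) y),
    MDiffAt (T% Y) x → MDiffAt (T% Z) x → ∀ u : TangentSpace 𝓘(ℝ, E) x,
      d% (fun y => S.g y (Y y) (Z y)) x u
        = S.g x (cov Y x u) (Z x) + S.g x (Y x) (cov Z x u)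

/-- The Nijenhuis tensor of `J_α`, evaluated on vector fields `X` and `Y`. -/
def nijenhuis (α : Fin 3) (X Y : ∀ y : N, TangentSpace 𝓘(ℝ, E) y) (x : N) :
    TangentSpace 𝓘(ℝ, E) x :=
  mlieBracket 𝓘(ℝ, E) (fun y => S.J α y (X y)) (fun y => S.J α y (Y y)) x
    - S.J α x (mlieBracket 𝓘(ℝ, E) (fun y => S.J α y (X y)) Y x)
    - S.J α x (mlieBracket 𝓘(ℝ, E) X (fun y => S.J α y (Y y)) x)
    - mlieBracket 𝓘(ℝ, E) X Y x

/-- `H` is hypercomplex: the Nijenhuis tensors of `J₁, J₂, J₃` vanish. -/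
def IsHypercomplex : Prop :=
  ∀ (α : Fin 3) (x : N) (X Y : ∀ y : N, TangentSpace 𝓘(ℝ, E) y),
    CMDiffAt ∞ (T% X) x → CMDiffAt ∞ (T% Y) x → S.nijenhuis α X Y x = 0

/-- `(∇_X J_α) Y = ∇_X (J_α Y) - J_α (∇_X Y)` for a vector field `Y`, as a function of `X`. -/
def covJField (α : Fin 3) (Y : ∀ y : N, TangentSpace 𝓘(ℝ, E) y) (x : N) :
    TangentSpace 𝓘(ℝ, E) x →L[ℝ] TangentSpace 𝓘(ℝ, E) x :=
  cov (fun y => S.J α y (Y y)) x - S.J α x ∘L cov Y x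

variable {S cov} in
/-- `(∇_X J_α) Y` depends on `Y` only through its value at the point. -/
theorem tensorialAt_covJField (α : Fin 3) (x : N) :
    TensorialAt 𝓘(ℝ, E) E (fun Y => S.covJField cov α Y x) x := by
  have hJ : ∀ {Y : ∀ y : N, TangentSpace 𝓘(ℝ, E) y}, MDiffAt (T% Y) x →
      MDiffAt (T% (fun y => S.J α y (Y y))) x := fun hY =>
    MDifferentiableAt.clm_bundle_apply
      (((S.contMDiff_J α).contMDiffAt (x := x)).mdifferentiableAt (by simp)) hY
  constructor
  · intro f Y hf hY
    have h1 : (fun y => S.J α y ((f • Y) y)) = f • (fun y => S.J α y (Y y)) := by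
      ext y; simp
    simp only [covJField, h1]
    rw [cov.isCovariantDerivativeOnUniv.leibniz (hJ hY) hf,
      cov.isCovariantDerivativeOnUniv.leibniz hY hf]
    ext u
    simp
    module
  · intro Y Z hY hZ
    have h1 : (fun y => S.J α y ((Y + Z) y)) =
        (fun y => S.J α y (Y y)) + (fun y => S.J α y (Z y)) := by
      ext y; simp
    simp only [covJField, h1]
    rw [cov.isCovariantDerivativeOnUniv.add (hJ hY) (hJ hZ),
      cov.isCovariantDerivativeOnUniv.add hY hZ]
    ext u
    simp
    module

/-- The endomorphism field `∇ J_α`: `covJ α x v u` is `(∇_u J_α) v`. -/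
def covJ (α : Fin 3) (x : N) : TangentSpace 𝓘(ℝ, E) x →L[ℝ]
    TangentSpace 𝓘(ℝ, E) x →L[ℝ] TangentSpace 𝓘(ℝ, E) x :=
  TensorialAt.mkHom (fun Y => S.covJField cov α Y x) x (S.tensorialAt_covJField α x)

/-- The fundamental tensor `F_α(u, v, w) = g((∇_u J_α) v, w)`. -/
def F (α : Fin 3) (x : N) (u v w : TangentSpace 𝓘(ℝ, E) x) : ℝ :=
  S.g x (S.covJ cov α x v u) w

/-- The Lee form `θ_α(w) = g^{ij} F_α(e_i, e_j, w)`. -/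
def lee (α : Fin 3) (x : N) (w : TangentSpace 𝓘(ℝ, E) x) : ℝ :=
  metricTrace (V := TangentSpace 𝓘(ℝ, E) x) (fun u v => S.g x u v) (fun u v => S.F cov α x u v w)

/-- The class `𝒲` in dimension `4n`: hypercomplex manifolds with Hermitian and Norden metrics whose
fundamental tensors have the following form in terms of the Lee forms. `cov` has to be the
Levi-Civita connection of `g`. -/
structure IsWManifold (n : ℕ) : Prop where
  hypercomplex : S.IsHypercomplex
  F_one : ∀ (x : N) (u v w : TangentSpace 𝓘(ℝ, E) x),
    S.F cov 0 x u v w = 1 / (2 * (2 * (n : ℝ) - 1)) *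
      (S.g x u v * S.lee cov 0 x w - S.g x u w * S.lee cov 0 x v
        - S.g x u (S.J 0 x v) * S.lee cov 0 x (S.J 0 x w)
        + S.g x u (S.J 0 x w) * S.lee cov 0 x (S.J 0 x v))
  F_two_three : ∀ α : Fin 3, α ≠ 0 → ∀ (x : N) (u v w : TangentSpace 𝓘(ℝ, E) x),
    S.F cov α x u v w = 1 / (4 * (n : ℝ)) *
      (S.g x u v * S.lee cov α x w + S.g x u w * S.lee cov α x v
        + S.g x u (S.J α x v) * S.lee cov α x (S.J α x w)
        + S.g x u (S.J α x w) * S.lee cov α x (S.J α x v))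

end AlmostHypercomplexHN
end Ambient

section Submanifold

variable {E : Type*} [NormedAddCommGroup E] [NormedSpace ℝ E] [FiniteDimensional ℝ E]
  {N : Type*} [TopologicalSpace N] [ChartedSpace E N] [IsManifold 𝓘(ℝ, E) ∞ N]
  {E' : Type*} [NormedAddCommGroup E'] [NormedSpace ℝ E'] [FiniteDimensional ℝ E']
  {M : Type*} [TopologicalSpace M] [ChartedSpace E' M] [IsManifold 𝓘(ℝ, E') ∞ M]

/-- The covariant derivative along a map `f : M → N` of a vector field `Y` along `f` in the direction
`v ∈ T_p M` (the connection on `f^* TN` induced by `cov`). If `(e_i)` is the frame of `TN` near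
`f p` that is constant in the preferred trivialization and `Y = ∑ yⁱ (e_i ∘ f)`, it is
`∑ dyⁱ(v) e_i + ∑ yⁱ(p) ∇_{df(v)} e_i`. -/
def covAlong (cov : CovariantDerivative 𝓘(ℝ, E) E (TangentSpace 𝓘(ℝ, E) : N → Type _))
    (f : M → N) (Y : ∀ q : M, TangentSpace 𝓘(ℝ, E) (f q)) (p : M) (v : TangentSpace 𝓘(ℝ, E') p) :
    TangentSpace 𝓘(ℝ, E) (f p) :=
  let t := trivializationAt E (TangentSpace 𝓘(ℝ, E) : N → Type _) (f p)
  t.symm (f p) (d% (fun q => (t ⟨f q, Y q⟩).2) p v)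
    + cov (extend E (Y p)) (f p) (mfderiv% f p v)

namespace AlmostHypercomplexHN

variable (S : AlmostHypercomplexHN (E := E) N) (f : M → N)

/-- `T_p M`, as a subspace of `T_{f p} N`. -/
def tangentSub (p : M) : Submodule ℝ (TangentSpace 𝓘(ℝ, E) (f p)) :=
  LinearMap.range (mfderiv 𝓘(ℝ, E') 𝓘(ℝ, E) f p).toLinearMap

/-- The normal space `T_p M^⊥`. -/
def normalSub (p : M) : Submodule ℝ (TangentSpace 𝓘(ℝ, E) (f p)) where
  carrier := {ν | ∀ τ ∈ tangentSub (E := E) (E' := E') f p, S.g (f p) τ ν = 0}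
  add_mem' ha hb τ hτ := by simp [ha τ hτ, hb τ hτ]
  zero_mem' τ _ := by simp
  smul_mem' c a ha τ hτ := by simp [ha τ hτ]

/-- The induced metric (restriction of `g` to `TM`). -/
def inducedMetric (p : M) (v w : TangentSpace 𝓘(ℝ, E') p) : ℝ :=
  S.g (f p) (mfderiv% f p v) (mfderiv% f p w)

/-- `f : M → N` is a holomorphic submanifold: an immersion whose tangent spaces satisfy
`J_α (T_p M) = T_p M` and whose induced metric has maximal rank. -/
structure IsHolomorphicSubmanifold : Prop where
  isImmersion : Manifold.IsImmersion 𝓘(ℝ, E') 𝓘(ℝ, E) ∞ f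
  holomorphic : ∀ α p, (tangentSub (E := E) (E' := E') f p).map (S.J α (f p)).toLinearMap
    = tangentSub (E := E) (E' := E') f p
  nondeg : ∀ (p : M) (v : TangentSpace 𝓘(ℝ, E') p), (∀ w, S.inducedMetric f p v w = 0) → v = 0

variable {S f}

theorem IsHolomorphicSubmanifold.isCompl (hM : S.IsHolomorphicSubmanifold (E' := E') f) (p : M) :
    IsCompl (S.normalSub (E' := E') f p) (tangentSub (E := E) (E' := E') f p) := by
  let B : LinearMap.BilinForm ℝ (TangentSpace 𝓘(ℝ, E) (f p)) :=
    LinearMap.mk₂ ℝ (fun u v => S.g (f p) u v) (by simp) (by simp) (by simp) (by simp)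
  have hB : B.IsSymm := ⟨fun u v => S.g_symm (f p) u v⟩
  have hT : S.normalSub (E' := E') f p
      = B.orthogonal (tangentSub (E := E) (E' := E') f p) := rfl
  rw [hT]
  refine ((LinearMap.BilinForm.isCompl_orthogonal_iff_disjoint hB.isRefl).2 ?_).symm
  rw [Submodule.disjoint_def]
  rintro _ ⟨v, rfl⟩ hv
  have : v = 0 := hM.nondeg p v fun w => by
    have := hv (mfderiv 𝓘(ℝ, E') 𝓘(ℝ, E) f p w) ⟨w, rfl⟩
    rw [inducedMetric, S.g_symm]
    exact this
  simp [this]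

/-- The normal component of a vector of `T_{f p} N`. -/
def IsHolomorphicSubmanifold.normalPart (hM : S.IsHolomorphicSubmanifold (E' := E') f) (p : M) :
    TangentSpace 𝓘(ℝ, E) (f p) →ₗ[ℝ] TangentSpace 𝓘(ℝ, E) (f p) :=
  Submodule.projection _ _ (hM.isCompl p)

/-- The second fundamental form: `h(v, w)` is the normal component of `∇_v W`, for any vector field
`W` on `M` with `W_p = w`. -/
def IsHolomorphicSubmanifold.secondFundamentalForm (hM : S.IsHolomorphicSubmanifold (E' := E') f)
    (cov : CovariantDerivative 𝓘(ℝ, E) E (TangentSpace 𝓘(ℝ, E) : N → Type _))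
    (p : M) (v w : TangentSpace 𝓘(ℝ, E') p) : TangentSpace 𝓘(ℝ, E) (f p) :=
  hM.normalPart p (covAlong cov f (fun q => mfderiv% f q (extend E' w q)) p v)

/-- The mean curvature vector `C = (1 / dim M) trace h`. -/
def IsHolomorphicSubmanifold.meanCurvature (hM : S.IsHolomorphicSubmanifold (E' := E') f)
    (cov : CovariantDerivative 𝓘(ℝ, E) E (TangentSpace 𝓘(ℝ, E) : N → Type _)) (p : M) :
    TangentSpace 𝓘(ℝ, E) (f p) :=
  (1 / (finrank ℝ E' : ℝ)) • metricTrace (S.inducedMetric f p) (hM.secondFundamentalForm cov p)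

/-- `M` is totally geodesic: `h = 0`. -/
def IsHolomorphicSubmanifold.IsTotallyGeodesic (hM : S.IsHolomorphicSubmanifold (E' := E') f)
    (cov : CovariantDerivative 𝓘(ℝ, E) E (TangentSpace 𝓘(ℝ, E) : N → Type _)) : Prop :=
  ∀ (p : M) (v w : TangentSpace 𝓘(ℝ, E') p), hM.secondFundamentalForm cov p v w = 0

/-- `M` is (properly) totally umbilical: `h(v, w) = g(v, w) C` everywhere, and the mean curvature
vector field `C` is not identically zero. -/
def IsHolomorphicSubmanifold.IsTotallyUmbilical (hM : S.IsHolomorphicSubmanifold (E' := E') f)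
    (cov : CovariantDerivative 𝓘(ℝ, E) E (TangentSpace 𝓘(ℝ, E) : N → Type _)) : Prop :=
  (∀ (p : M) (v w : TangentSpace 𝓘(ℝ, E') p),
    hM.secondFundamentalForm cov p v w = S.inducedMetric f p v w • hM.meanCurvature cov p) ∧
  ∃ p : M, hM.meanCurvature cov p ≠ 0

end AlmostHypercomplexHN
end Submanifold
end HermitianNorden
end

/-! Everything rests on how `h` interacts with each `J_α`. Differentiating `J_α W` for a tangent
field `W` and taking normal parts gives `h(v, J_α w) = J_α h(v,w) + ((∇_v J_α) w)^⊥`. In the formula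
for `F_α(v,w,ν)` with `ν` normal, the terms containing `g(v,ν)` or `g(v, J_α ν)` vanish. Let `A_α`
be the normal vector dual to `c_α θ_α` on the normal space (`leeNormal`), where `c_α` is the
constant in that formula. What remains is `h(v, J_α w) = J_α h(v,w) + g(v,w) A_α + g(v, J_α w) J_α
A_α` (R).

Since `h` is symmetric, two uses of (R) give `h(J_α v, J_α w) = -h(v,w) + (g(v,w) + g(J_α v, J_α w))
J_α A_α`. For the Norden structures `J₂`, `J₃` the bracket is zero, so `h` changes sign under each
and is invariant under `J₁ = J₂ J₃`. For the Hermitian `J₁` the bracket is `2 g(v,w)`. Hence `h = g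
· J₁ A₁`, and tracing gives `C = J₁ A₁`. Substituting `h = g · C` back into (R) makes `C - J_α A_α`
satisfy `J_α D = a D` with `a` real, which forces `D = 0` because `J_α² = -1`. So `C = J_α A_α` for
every `α`, and `C` vanishes at a point exactly when any one, equivalently each, `θ_α` vanishes on
the normal space there.

The analytic input is `covAlong_J` (Leibniz rule along `f`), `covAlong_mfderiv_extend_symm`
(symmetry of `h`) and `exists_covAlong_mfderiv_sub` (independence of the extension). The algebra is
in `eq_smul_of_complexLinear_up_to` and `eq_of_smul_complexLinear_up_to`. -/

noncomputable section

set_option linter.unusedSectionVars false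

namespace HermitianNorden

/-! ### Calculus of vector-valued functions on manifolds. -/

section
variable {E : Type*} [NormedAddCommGroup E] [NormedSpace ℝ E]
  {N : Type*} [TopologicalSpace N] [ChartedSpace E N] 
  {F G : Type*} [NormedAddCommGroup F] [NormedSpace ℝ F] [NormedAddCommGroup G] [NormedSpace ℝ G]

theorem mvfderiv_clm_apply {A : N → F →L[ℝ] G} {y : N → F} {x : N}
    (hA : MDiffAt A x) (hy : MDiffAt y x) (v : TangentSpace 𝓘(ℝ, E) x) :
    d% (fun q => A q (y q)) x v = (d% A x v) (y x) + A x (d% y x v) := by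
  have h : HasMFDerivAt 𝓘(ℝ, E) 𝓘(ℝ, G) (fun q => A q (y q)) x
      (((ContinuousLinearMap.apply ℝ G (y x)).comp (d% A x)) + (A x).comp (d% y x)) := by
    refine ⟨(hA.clm_apply hy).continuousAt, ?_⟩
    convert! hA.hasMFDerivAt.2.clm_apply hy.hasMFDerivAt.2 using 1
    rw [add_comm]
    simp [mvfderiv, writtenInExtChartAt]
    rfl
  exact congr($(h.mfderiv) v)

theorem mvfderiv_congr {y z : N → F} {x : N} (h : y =ᶠ[nhds x] z) : d% y x = d% z x := by
  ext v
  exact congr($(h.mfderiv_eq (I := 𝓘(ℝ, E)) (I' := 𝓘(ℝ, F))) v)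

theorem mvfderiv_eq_zero_of_eventually_const {y : N → F} {x : N} {c : F}
    (h : ∀ᶠ q in nhds x, y q = c) : d% y x = 0 := by
  rw [mvfderiv_congr (z := fun _ => c) h]
  exact mvfderiv_const c

theorem mvfderiv_comp_mfderiv {E' : Type*} [NormedAddCommGroup E'] [NormedSpace ℝ E'] {M : Type*}
    [TopologicalSpace M] [ChartedSpace E' M] {f : M → N} {y : N → F} {p : M}
    (hy : MDiffAt y (f p)) (hf : MDiffAt f p) (v : TangentSpace 𝓘(ℝ, E') p) :
    d% (fun q => y (f q)) p v = d% y (f p) (mfderiv% f p v) :=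
  mfderiv_comp_apply p hy hf v
end

/-! ### Covariant derivatives in the preferred trivialization. -/

section
variable {E : Type*} [NormedAddCommGroup E] [NormedSpace ℝ E] [FiniteDimensional ℝ E]
  {N : Type*} [TopologicalSpace N] [ChartedSpace E N] [IsManifold 𝓘(ℝ, E) ∞ N]

theorem eventually_trivialization_extend {x : N} (u : TangentSpace 𝓘(ℝ, E) x) :
    ∀ᶠ y in nhds x, (trivializationAt E (TangentSpace 𝓘(ℝ, E) : N → Type _) x
      ⟨y, extend E u y⟩).2 = (trivializationAt E (TangentSpace 𝓘(ℝ, E) : N → Type _) x ⟨x, u⟩).2 := by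
  filter_upwards [(trivializationAt E (TangentSpace 𝓘(ℝ, E) : N → Type _) x).open_baseSet.mem_nhds
    (mem_baseSet_trivializationAt E _ x)] with y hy
  rw [extend, Trivialization.apply_mk_symm _ hy]

/-- The difference between a covariant derivative and the flat one given by the preferred
trivialization is tensorial. -/
theorem cov_eq_symm_add_extend
    (cov : CovariantDerivative 𝓘(ℝ, E) E (TangentSpace 𝓘(ℝ, E) : N → Type _)) {x : N}
    {Y : ∀ y : N, TangentSpace 𝓘(ℝ, E) y} (hY : MDiffAt (T% Y) x) (u : TangentSpace 𝓘(ℝ, E) x) :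
    cov Y x u = (trivializationAt E (TangentSpace 𝓘(ℝ, E) : N → Type _) x).symm x
        (d% (fun y => (trivializationAt E (TangentSpace 𝓘(ℝ, E) : N → Type _) x ⟨y, Y y⟩).2) x u)
      + cov (extend E (Y x)) x u := by
  set t := trivializationAt E (TangentSpace 𝓘(ℝ, E) : N → Type _) x with ht
  have hx : x ∈ t.baseSet := mem_baseSet_trivializationAt E _ x
  have hbase := t.open_baseSet.mem_nhds hx
  let Φ : (∀ y : N, TangentSpace 𝓘(ℝ, E) y) → TangentSpace 𝓘(ℝ, E) x := fun Y =>
    cov Y x u - t.symmL ℝ x (d% (fun y => (t ⟨y, Y y⟩).2) x u)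
  have hΦ : TensorialAt 𝓘(ℝ, E) E Φ x := by
    constructor
    · intro f Z hf hZ
      have hZ' := (mdifferentiableAt_section _ Z).1 hZ
      have h1 : d% (fun y => (t ⟨y, (f • Z) y⟩).2) x
          = d% (f • fun y => (t ⟨y, Z y⟩).2) x := by
        refine mvfderiv_congr ?_
        filter_upwards [hbase] with y hy
        exact (t.linear ℝ hy).map_smul (f y) (Z y)
      simp only [Φ]
      rw [h1, mvfderiv_smul hf hZ', cov.isCovariantDerivativeOnUniv.leibniz hZ hf]
      have h2 : t.symmL ℝ x (t ⟨x, Z x⟩).2 = Z x := by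
        rw [Trivialization.symmL_apply _ hx]; exact t.symm_apply_apply_mk hx (Z x)
      simp only [add_apply, smul_apply,
        ContinuousLinearMap.smulRight_apply, map_add, map_smul]
      rw [h2]
      module
    · intro Z W hZ hW
      have hZ' := (mdifferentiableAt_section _ Z).1 hZ
      have hW' := (mdifferentiableAt_section _ W).1 hW
      have h1 : d% (fun y => (t ⟨y, (Z + W) y⟩).2) x
          = d% ((fun y => (t ⟨y, Z y⟩).2) + fun y => (t ⟨y, W y⟩).2) x := by
        refine mvfderiv_congr ?_
        filter_upwards [hbase] with y hy
        exact (t.linear ℝ hy).map_add (Z y) (W y)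
      simp only [Φ]
      rw [h1, mvfderiv_add hZ' hW', cov.isCovariantDerivativeOnUniv.add hZ hW]
      simp only [add_apply, map_add]
      module
  -- The extension has constant coordinates near `x`, so on it the flat derivative is zero and only
  -- the connection term survives.
  have key : Φ Y = Φ (extend E (Y x)) :=
    hΦ.pointwise hY (mdifferentiableAt_extend ..) (by simp)
  simp only [Φ] at key
  rw [mvfderiv_eq_zero_of_eventually_const (eventually_trivialization_extend (Y x))] at key
  simp only [zero_apply, map_zero, sub_zero] at key
  rw [← key]
  rw [Trivialization.symmL_apply _ hx]
  abel

end

/-! ### Symmetry of second derivatives and of the connection coefficients. -/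

section
variable {E : Type*} [NormedAddCommGroup E] [NormedSpace ℝ E] [FiniteDimensional ℝ E]
  {N : Type*} [TopologicalSpace N] [ChartedSpace E N] [IsManifold 𝓘(ℝ, E) ∞ N]
  {E' : Type*} [NormedAddCommGroup E'] [NormedSpace ℝ E'] [FiniteDimensional ℝ E']
  {M : Type*} [TopologicalSpace M] [ChartedSpace E' M] [IsManifold 𝓘(ℝ, E') ∞ M]

theorem one_add_one_le_infty : (1 + 1 : ℕ∞ω) ≤ ∞ := by
  rw [one_add_one_eq_two]
  exact (inferInstance : ENat.LEInfty 2).out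

theorem inverse_symmL_symm (t : Trivialization E (TotalSpace.proj : TangentBundle 𝓘(ℝ, E) N → N))
    [MemTrivializationAtlas t] {y : N} (hy : y ∈ t.baseSet) (c : E) :
    (t.symmL ℝ y).inverse (t.symm y c) = c := by
  rw [← t.symm_continuousLinearEquivAt_eq' hy, ContinuousLinearMap.inverse_equiv]
  exact congr_arg Prod.snd (t.apply_mk_symm hy c)

/-- Extensions of tangent vectors by constants in the same chart commute at the base point. -/
theorem mlieBracket_extend (x : N) (u v : TangentSpace 𝓘(ℝ, E) x) :
    mlieBracket 𝓘(ℝ, E) (extend E u) (extend E v) x = 0 := by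
  -- The trivialization at `x` is the derivative of the chart at `x`, so in that chart the extension
  -- is a constant field.
  have key : ∀ u : TangentSpace 𝓘(ℝ, E) x, ∃ c : E,
      mpullbackWithin 𝓘(ℝ, E) 𝓘(ℝ, E) (extChartAt 𝓘(ℝ, E) x).symm (extend E u) (Set.range 𝓘(ℝ, E))
        =ᶠ[nhds (extChartAt 𝓘(ℝ, E) x x)] fun _ => c := by
    intro u
    refine ⟨(trivializationAt E (TangentSpace 𝓘(ℝ, E) : N → Type _) x ⟨x, u⟩).2, ?_⟩
    filter_upwards [(isOpen_extChartAt_target (I := 𝓘(ℝ, E)) x).mem_nhds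
      (mem_extChartAt_target (I := 𝓘(ℝ, E)) x)] with z hz
    have hz' : (extChartAt 𝓘(ℝ, E) x).symm z ∈ (chartAt E x).source := by
      simpa using (extChartAt 𝓘(ℝ, E) x).map_target hz
    have h1 := TangentBundle.symmL_trivializationAt (I := 𝓘(ℝ, E)) hz'
    rw [PartialEquiv.right_inv _ hz] at h1
    rw [mpullbackWithin_apply, ← h1]
    exact inverse_symmL_symm _ hz' _
  obtain ⟨c, hc⟩ := key u
  obtain ⟨d, hd⟩ := key v
  have h : lieBracketWithin ℝ
      (mpullbackWithin 𝓘(ℝ, E) 𝓘(ℝ, E) (extChartAt 𝓘(ℝ, E) x).symm (extend E u) (Set.range 𝓘(ℝ, E)))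
      (mpullbackWithin 𝓘(ℝ, E) 𝓘(ℝ, E) (extChartAt 𝓘(ℝ, E) x).symm (extend E v) (Set.range 𝓘(ℝ, E)))
      ((extChartAt 𝓘(ℝ, E) x).symm ⁻¹' Set.univ ∩ Set.range 𝓘(ℝ, E)) (extChartAt 𝓘(ℝ, E) x x) = 0 := by
    rw [Filter.EventuallyEq.lieBracketWithin_vectorField_eq (hc.filter_mono inf_le_left)
      hc.self_of_nhds (hd.filter_mono inf_le_left) hd.self_of_nhds]
    simp [lieBracketWithin]
  rw [← mlieBracketWithin_univ, mlieBracketWithin_apply, h]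
  exact map_zero (mfderiv% (extChartAt 𝓘(ℝ, E) x) x).inverse

theorem extend_symm_of_torsion_eq_zero
    {cov : CovariantDerivative 𝓘(ℝ, E) E (TangentSpace 𝓘(ℝ, E) : N → Type _)}
    (hcov : cov.torsion = 0) (x : N) (u v : TangentSpace 𝓘(ℝ, E) x) :
    cov (extend E v) x u = cov (extend E u) x v := by
  have h := CovariantDerivative.torsion_eq_zero_iff cov |>.1 hcov
    (mdifferentiableAt_extend 𝓘(ℝ, E) E u) (mdifferentiableAt_extend 𝓘(ℝ, E) E v)
  rw [mlieBracket_extend] at h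
  simpa using sub_eq_zero.1 h

/-- The differential of `f` in the preferred trivializations at `p` and `f p`. -/
def mfderivInCoordinates (f : M → N) (p q : M) : E' →L[ℝ] E :=
  inTangentCoordinates 𝓘(ℝ, E') 𝓘(ℝ, E) id f (mfderiv% f) p q

theorem mdifferentiableAt_mfderivInCoordinates {f : M → N} {p : M}
    (hf : ContMDiff 𝓘(ℝ, E') 𝓘(ℝ, E) ∞ f) :
    MDiffAt (mfderivInCoordinates (E := E) (E' := E') f p) p :=
  ((hf p).mfderiv_const (m := 1) one_add_one_le_infty).mdifferentiableAt (by simp)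

theorem eventually_trivialization_mfderiv {f : M → N} {p : M} (hf : ContinuousAt f p) :
    ∀ᶠ q in nhds p, ∀ w : TangentSpace 𝓘(ℝ, E') q,
      (trivializationAt E (TangentSpace 𝓘(ℝ, E) : N → Type _) (f p) ⟨f q, mfderiv% f q w⟩).2
        = mfderivInCoordinates (E := E) (E' := E') f p q
          (trivializationAt E' (TangentSpace 𝓘(ℝ, E') : M → Type _) p ⟨q, w⟩).2 := by
  have h1 := (trivializationAt E' (TangentSpace 𝓘(ℝ, E') : M → Type _) p).open_baseSet.mem_nhds
    (mem_baseSet_trivializationAt E' _ p)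
  have h2 := (trivializationAt E (TangentSpace 𝓘(ℝ, E) : N → Type _) (f p)).open_baseSet.mem_nhds
    (mem_baseSet_trivializationAt E _ (f p))
  filter_upwards [h1, hf h2] with q hq1 hq2 w
  unfold mfderivInCoordinates inTangentCoordinates ContinuousLinearMap.inCoordinates
  have h3 := Trivialization.symm_apply_apply_mk
    (trivializationAt E' (TangentSpace 𝓘(ℝ, E') : M → Type _) p) hq1 w
  rw [← Trivialization.symmL_apply (R := ℝ) _ hq1] at h3
  simp only [ContinuousLinearMap.coe_comp, Function.comp_apply]
  erw [h3]
  exact (congrFun (Trivialization.coe_linearMapAt_of_mem (R := ℝ) _ hq2) (mfderiv% f q w)).symm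

/-- Near `p` the coordinate differential is `fderiv ℝ G` read through the chart, where `G` is `f` in
charts. Its derivative is the second derivative of `G`, symmetric by Schwarz. -/
theorem mvfderiv_mfderivInCoordinates_symm {f : M → N} {p : M}
    (hf : ContMDiff 𝓘(ℝ, E') 𝓘(ℝ, E) ∞ f) (v w : TangentSpace 𝓘(ℝ, E') p) :
    d% (mfderivInCoordinates (E := E) (E' := E') f p) p v
        (trivializationAt E' (TangentSpace 𝓘(ℝ, E') : M → Type _) p ⟨p, w⟩).2
      = d% (mfderivInCoordinates (E := E) (E' := E') f p) p w
        (trivializationAt E' (TangentSpace 𝓘(ℝ, E') : M → Type _) p ⟨p, v⟩).2 := by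
  set φ := extChartAt 𝓘(ℝ, E') p with hφ
  set G : E' → E := writtenInExtChartAt 𝓘(ℝ, E') 𝓘(ℝ, E) p f with hG
  have hGs : ContDiffAt ℝ ∞ G (φ p) := by
    have := (contMDiffAt_iff.1 (hf p)).2
    rw [modelWithCornersSelf_coe, Set.range_id, contDiffWithinAt_univ] at this
    exact this
  have hA : ∀ᶠ q in nhds p,
      mfderivInCoordinates (E := E) (E' := E') f p q = fderiv ℝ G (φ q) := by
    have h1 := (chartAt E' p).open_source.mem_nhds (mem_chart_source E' p)
    have h2 := (chartAt E (f p)).open_source.mem_nhds (mem_chart_source E (f p))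
    filter_upwards [h1, hf.continuous.continuousAt h2] with q hq1 hq2
    have hq : φ.symm (φ q) = q := φ.left_inv (by simpa [hφ] using hq1)
    have h4 : MDiffAt f (φ.symm (φ q)) := hf.mdifferentiable (by simp) _
    have h5 : MDiffAt (extChartAt 𝓘(ℝ, E) (f p)) (f (φ.symm (φ q))) := by
      rw [hq]; exact mdifferentiableAt_extChartAt hq2
    have h6 : MDiffAt φ.symm (φ q) := by
      have := mdifferentiableWithinAt_extChartAt_symm (I := 𝓘(ℝ, E')) (x := p) (z := φ q)
        (φ.map_source (by simpa [hφ] using hq1))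
      rwa [modelWithCornersSelf_coe, Set.range_id, mdifferentiableWithinAt_univ] at this
    unfold mfderivInCoordinates
    rw [inTangentCoordinates_eq_mfderiv_comp (by exact hq1) hq2]
    rw [← mfderiv_eq_fderiv]
    have h7 : mfderiv 𝓘(ℝ, E') 𝓘(ℝ, E) G (φ q)
        = (mfderiv% (extChartAt 𝓘(ℝ, E) (f p)) (f (φ.symm (φ q)))) ∘L
          (mfderiv% f (φ.symm (φ q))) ∘L (mfderiv% φ.symm (φ q)) := by
      rw [← mfderiv_comp (φ q) h4 h6]
      exact mfderiv_comp (φ q) h5 (h4.comp _ h6)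
    rw [h7, hq, modelWithCornersSelf_coe, Set.range_id, mfderivWithin_univ]
    rfl
  -- Identifies trivialization coordinates with `dφ`, so that both slots of the second derivative
  -- are of the same form.
  have hφd : ∀ u : TangentSpace 𝓘(ℝ, E') p,
      (trivializationAt E' (TangentSpace 𝓘(ℝ, E') : M → Type _) p ⟨p, u⟩).2 = mfderiv% φ p u := by
    intro u
    rw [← TangentBundle.continuousLinearMapAt_trivializationAt (mem_chart_source E' p)]
    exact (congrFun (Trivialization.coe_linearMapAt_of_mem (R := ℝ) _
      (mem_baseSet_trivializationAt E' _ p)) u).symm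
  have hdiff : DifferentiableAt ℝ (fderiv ℝ G) (φ p) :=
    (hGs.fderiv_right (m := 1) one_add_one_le_infty).differentiableAt (by simp)
  have hd : ∀ u : TangentSpace 𝓘(ℝ, E') p, d% (mfderivInCoordinates (E := E) (E' := E') f p) p u
      = fderiv ℝ (fderiv ℝ G) (φ p) (mfderiv% φ p u) := by
    intro u
    rw [mvfderiv_congr hA]
    rw [mvfderiv_comp_mfderiv (N := E') (f := φ) (y := fderiv ℝ G) hdiff.mdifferentiableAt
      (mdifferentiableAt_extChartAt (mem_chart_source E' p))]
    exact congr($(mfderiv_eq_fderiv (f := fderiv ℝ G) (x := φ p)) (mfderiv% φ p u))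
  rw [hd, hd, hφd, hφd]
  exact hGs.isSymmSndFDerivAt (by simpa using (inferInstance : ENat.LEInfty 2).out) _ _

end

/-! ### Covariant derivative along a map: Leibniz rule for `J_α` and dependence on the extension. -/

section
variable {E : Type*} [NormedAddCommGroup E] [NormedSpace ℝ E] [FiniteDimensional ℝ E]
  {N : Type*} [TopologicalSpace N] [ChartedSpace E N] [IsManifold 𝓘(ℝ, E) ∞ N]
  {E' : Type*} [NormedAddCommGroup E'] [NormedSpace ℝ E'] [FiniteDimensional ℝ E']
  {M : Type*} [TopologicalSpace M] [ChartedSpace E' M] [IsManifold 𝓘(ℝ, E') ∞ M]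

/-- `K` is the matrix of `J_α` in a fixed trivialization; with it the ordinary product rule applies
to `J_α Y`. -/
theorem AlmostHypercomplexHN.exists_J_inCoordinates (S : AlmostHypercomplexHN (E := E) N)
    (α : Fin 3) (x : N) : ∃ K : N → E →L[ℝ] E, MDiffAt K x ∧
      ∀ᶠ y in nhds x, ∀ u : TangentSpace 𝓘(ℝ, E) y,
        (trivializationAt E (TangentSpace 𝓘(ℝ, E) : N → Type _) x ⟨y, S.J α y u⟩).2
          = K y (trivializationAt E (TangentSpace 𝓘(ℝ, E) : N → Type _) x ⟨y, u⟩).2 := by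
  have h := ((contMDiffAt_hom_bundle _).1 (S.contMDiff_J α x)).2.mdifferentiableAt (by simp)
  refine ⟨_, h, ?_⟩
  filter_upwards [(trivializationAt E (TangentSpace 𝓘(ℝ, E) : N → Type _) x).open_baseSet.mem_nhds
    (mem_baseSet_trivializationAt E _ x)] with y hy u
  have h3 := Trivialization.symm_apply_apply_mk
    (trivializationAt E (TangentSpace 𝓘(ℝ, E) : N → Type _) x) hy u
  rw [← Trivialization.symmL_apply (R := ℝ) _ hy] at h3
  simp only [ContinuousLinearMap.inCoordinates, ContinuousLinearMap.coe_comp, Function.comp_apply]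
  erw [h3]
  exact (congrFun (Trivialization.coe_linearMapAt_of_mem (R := ℝ) _ hy) (S.J α y u)).symm

/-- In coordinates, differentiating `K y` gives `dK(u) y + K dy(v)`. The first term is isolated by
applying the connection to `J_α` of the constant-coordinate extension of `Y p`, and this is what
enters `covJ`. -/
theorem AlmostHypercomplexHN.covAlong_J (S : AlmostHypercomplexHN (E := E) N)
    (cov : CovariantDerivative 𝓘(ℝ, E) E (TangentSpace 𝓘(ℝ, E) : N → Type _)) (α : Fin 3)
    {f : M → N} {p : M} (hf : MDiffAt f p) {Y : ∀ q : M, TangentSpace 𝓘(ℝ, E) (f q)}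
    (hY : MDiffAt (fun q =>
      (trivializationAt E (TangentSpace 𝓘(ℝ, E) : N → Type _) (f p) ⟨f q, Y q⟩).2) p)
    (v : TangentSpace 𝓘(ℝ, E') p) :
    covAlong cov f (fun q => S.J α (f q) (Y q)) p v
      = S.covJ cov α (f p) (Y p) (mfderiv% f p v) + S.J α (f p) (covAlong cov f Y p v) := by
  obtain ⟨K, hK, hJK⟩ := S.exists_J_inCoordinates α (f p)
  set t := trivializationAt E (TangentSpace 𝓘(ℝ, E) : N → Type _) (f p) with ht
  have hp : f p ∈ t.baseSet := mem_baseSet_trivializationAt E _ (f p)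
  set u := mfderiv% f p v with hu
  -- the derivative of `J Y` along `f`
  have h1 : d% (fun q => (t ⟨f q, S.J α (f q) (Y q)⟩).2) p v
      = d% K (f p) u (t ⟨f p, Y p⟩).2 + K (f p) (d% (fun q => (t ⟨f q, Y q⟩).2) p v) := by
    rw [mvfderiv_congr (z := fun q => K (f q) (t ⟨f q, Y q⟩).2)
      ((hf.continuousAt.eventually hJK).mono fun q hq => hq (Y q)),
      mvfderiv_clm_apply (A := fun q => K (f q)) (hK.comp p hf) hY, mvfderiv_comp_mfderiv hK hf]
  -- the derivative of `J Y` for the extension of `Y p`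
  have hext := mdifferentiableAt_extend 𝓘(ℝ, E) E (Y p)
  have hext' : MDiffAt (fun y => (t ⟨y, extend E (Y p) y⟩).2) (f p) :=
    (mdifferentiableAt_section _ _).1 hext
  have h2 : d% (fun y => (t ⟨y, S.J α y (extend E (Y p) y)⟩).2) (f p) u
      = d% K (f p) u (t ⟨f p, Y p⟩).2 := by
    rw [mvfderiv_congr (z := fun y => K y (t ⟨y, extend E (Y p) y⟩).2)
      (hJK.mono fun q hq => hq _), mvfderiv_clm_apply hK hext',
      mvfderiv_eq_zero_of_eventually_const (eventually_trivialization_extend (Y p))]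
    simp
  have hJext : MDiffAt (T% (fun y => S.J α y (extend E (Y p) y))) (f p) :=
    MDifferentiableAt.clm_bundle_apply
      (((S.contMDiff_J α).contMDiffAt (x := f p)).mdifferentiableAt (by simp)) hext
  have h3 := cov_eq_symm_add_extend cov hJext u
  rw [← ht, h2] at h3
  -- Definitional, because `TensorialAt.mkHom` evaluates the tensor on the extension of the vector.
  have h4 : S.covJ cov α (f p) (Y p) u
      = cov (fun y => S.J α y (extend E (Y p) y)) (f p) u
        - S.J α (f p) (cov (extend E (Y p)) (f p) u) := rfl
  have h5 : ∀ e : E, S.J α (f p) (t.symm (f p) e) = t.symm (f p) (K (f p) e) := by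
    intro e
    rw [← t.symm_apply_apply_mk hp (S.J α (f p) (t.symm (f p) e)), hJK.self_of_nhds,
      t.apply_mk_symm hp]
  have hadd : ∀ a b : E, t.symm (f p) (a + b) = t.symm (f p) a + t.symm (f p) b := by
    intro a b
    simp only [← t.symmL_apply (R := ℝ) hp, map_add]
  unfold covAlong
  simp only [← ht]
  rw [h1, h4, h3, map_add, h5, hadd]
  simp only [extend_apply_self]
  abel

/-- A left inverse of an injective differential, in coordinates. -/
theorem exists_leftInverse_mfderivInCoordinates {f : M → N} {p : M}
    (hf : ContinuousAt f p) (hinj : Function.Injective (mfderiv 𝓘(ℝ, E') 𝓘(ℝ, E) f p)) :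
    ∃ L : E →L[ℝ] E', L ∘L mfderivInCoordinates (E := E) (E' := E') f p p = 1 := by
  have h := (eventually_trivialization_mfderiv (E := E) (E' := E') hf).self_of_nhds
  set t := trivializationAt E (TangentSpace 𝓘(ℝ, E) : N → Type _) (f p) with ht
  set t' := trivializationAt E' (TangentSpace 𝓘(ℝ, E') : M → Type _) p with ht'
  have hp : f p ∈ t.baseSet := mem_baseSet_trivializationAt E _ (f p)
  have hp' : p ∈ t'.baseSet := mem_baseSet_trivializationAt E' _ p
  have hA : Function.Injective (mfderivInCoordinates (E := E) (E' := E') f p p) := by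
    intro a b hab
    have hs : ∀ c : E', (t' ⟨p, t'.symm p c⟩).2 = c := fun c =>
      congr_arg Prod.snd (t'.apply_mk_symm hp' c)
    rw [← hs a, ← hs b, ← h, ← h] at hab
    have := congr_arg (t.symm (f p)) hab
    rw [t.symm_apply_apply_mk hp, t.symm_apply_apply_mk hp] at this
    have h2 := congr_arg (fun w => (t' ⟨p, w⟩).2) (hinj this)
    rwa [hs, hs] at h2
  obtain ⟨L, hL⟩ := LinearMap.exists_leftInverse_of_injective
    (mfderivInCoordinates (E := E) (E' := E') f p p).toLinearMap (LinearMap.ker_eq_bot.2 hA)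
  refine ⟨LinearMap.toContinuousLinearMap L, ?_⟩
  ext x
  exact congr($hL x)

theorem mdifferentiableAt_mfderiv_extend {f : M → N} (hf : ContMDiff 𝓘(ℝ, E') 𝓘(ℝ, E) ∞ f) {p : M}
    (w : TangentSpace 𝓘(ℝ, E') p) : MDiffAt (fun q =>
      (trivializationAt E (TangentSpace 𝓘(ℝ, E) : N → Type _) (f p)
        ⟨f q, mfderiv% f q (extend E' w q)⟩).2) p := by
  have h := (mdifferentiableAt_mfderivInCoordinates (p := p) hf).clm_apply
    ((mdifferentiableAt_section 𝓘(ℝ, E') _).1 (mdifferentiableAt_extend 𝓘(ℝ, E') E' w))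
  exact h.congr_of_eventuallyEq
    ((eventually_trivialization_mfderiv hf.continuous.continuousAt).mono fun q hq => hq _)

/-- The extension of `w` has constant coordinates, so only the second derivative of `f` and the
connection coefficients remain, and each is symmetric when the torsion is zero. -/
theorem covAlong_mfderiv_extend
    (cov : CovariantDerivative 𝓘(ℝ, E) E (TangentSpace 𝓘(ℝ, E) : N → Type _))
    {f : M → N} (hf : ContMDiff 𝓘(ℝ, E') 𝓘(ℝ, E) ∞ f) {p : M} (v w : TangentSpace 𝓘(ℝ, E') p) :
    covAlong cov f (fun q => mfderiv% f q (extend E' w q)) p v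
      = (trivializationAt E (TangentSpace 𝓘(ℝ, E) : N → Type _) (f p)).symm (f p)
          (d% (mfderivInCoordinates (E := E) (E' := E') f p) p v
            (trivializationAt E' (TangentSpace 𝓘(ℝ, E') : M → Type _) p ⟨p, w⟩).2)
        + cov (extend E (mfderiv% f p w)) (f p) (mfderiv% f p v) := by
  unfold covAlong
  dsimp only
  rw [mvfderiv_congr ((eventually_trivialization_mfderiv hf.continuous.continuousAt).mono
      fun q hq => hq _), mvfderiv_clm_apply (mdifferentiableAt_mfderivInCoordinates hf)
    ((mdifferentiableAt_section 𝓘(ℝ, E') _).1 (mdifferentiableAt_extend 𝓘(ℝ, E') E' w)),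
    mvfderiv_eq_zero_of_eventually_const (eventually_trivialization_extend w)]
  simp

/-- The Gauss formula is symmetric for a torsion-free connection. -/
theorem covAlong_mfderiv_extend_symm
    {cov : CovariantDerivative 𝓘(ℝ, E) E (TangentSpace 𝓘(ℝ, E) : N → Type _)}
    (hcov : cov.torsion = 0)
    {f : M → N} (hf : ContMDiff 𝓘(ℝ, E') 𝓘(ℝ, E) ∞ f) {p : M} (v w : TangentSpace 𝓘(ℝ, E') p) :
    covAlong cov f (fun q => mfderiv% f q (extend E' w q)) p v
      = covAlong cov f (fun q => mfderiv% f q (extend E' v q)) p w := by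
  rw [covAlong_mfderiv_extend cov hf, covAlong_mfderiv_extend cov hf,
    mvfderiv_mfderivInCoordinates_symm hf, extend_symm_of_torsion_eq_zero hcov]

/-- Modulo tangent vectors, the covariant derivative of a tangent vector field along an immersion
depends only on the value of the field at the point. The field is not assumed to be the image of a
differentiable field on the source. -/
theorem exists_covAlong_mfderiv_sub
    (cov : CovariantDerivative 𝓘(ℝ, E) E (TangentSpace 𝓘(ℝ, E) : N → Type _))
    {f : M → N} (hf : ContMDiff 𝓘(ℝ, E') 𝓘(ℝ, E) ∞ f) {p : M}
    (hinj : Function.Injective (mfderiv 𝓘(ℝ, E') 𝓘(ℝ, E) f p))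
    {W W' : ∀ q : M, TangentSpace 𝓘(ℝ, E') q}
    (hW : MDiffAt (fun q => (trivializationAt E (TangentSpace 𝓘(ℝ, E) : N → Type _) (f p)
        ⟨f q, mfderiv% f q (W q)⟩).2) p)
    (hW' : MDiffAt (fun q => (trivializationAt E (TangentSpace 𝓘(ℝ, E) : N → Type _) (f p)
        ⟨f q, mfderiv% f q (W' q)⟩).2) p)
    (hWW' : W p = W' p) (v : TangentSpace 𝓘(ℝ, E') p) :
    ∃ u : TangentSpace 𝓘(ℝ, E') p,
      covAlong cov f (fun q => mfderiv% f q (W q)) p v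
        = covAlong cov f (fun q => mfderiv% f q (W' q)) p v + mfderiv% f p u := by
  have hc : ContinuousAt f p := hf.continuous.continuousAt
  have hev := eventually_trivialization_mfderiv (E := E) (E' := E') hc
  obtain ⟨L, hL⟩ := exists_leftInverse_mfderivInCoordinates hc hinj
  have hA := mdifferentiableAt_mfderivInCoordinates (p := p) hf
  set A := mfderivInCoordinates (E := E) (E' := E') f p with hAdef
  set t := trivializationAt E (TangentSpace 𝓘(ℝ, E) : N → Type _) (f p) with ht
  set t' := trivializationAt E' (TangentSpace 𝓘(ℝ, E') : M → Type _) p with ht'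
  have hp : f p ∈ t.baseSet := mem_baseSet_trivializationAt E _ (f p)
  have hp' : p ∈ t'.baseSet := mem_baseSet_trivializationAt E' _ p
  have hLA : MDiffAt (fun q => L ∘L A q) p := mdifferentiableAt_const.clm_comp hA
  -- `L ∘L A p = 1`, so `L ∘L A q` is invertible near `p` and its inverse is differentiable at `p`.
  -- Applying this inverse and `L` to the pushforward recovers `W`, hence its differentiability.
  have hinv : MDiffAt (fun q => Ring.inverse (L ∘L A q)) p := by
    have h1 : DifferentiableAt ℝ (Ring.inverse : (E' →L[ℝ] E') → E' →L[ℝ] E') (L ∘L A p) := by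
      rw [hL]
      exact differentiableAt_inverse isUnit_one
    exact h1.mdifferentiableAt.comp p hLA
  have hunit : ∀ᶠ q in nhds p, IsUnit (L ∘L A q) := by
    have : IsUnit (L ∘L A p) := by rw [hL]; exact isUnit_one
    exact hLA.continuousAt.eventually (Units.isOpen.mem_nhds this)
  have hcoord : ∀ {W : ∀ q : M, TangentSpace 𝓘(ℝ, E') q},
      MDiffAt (fun q => (t ⟨f q, mfderiv% f q (W q)⟩).2) p →
      MDiffAt (fun q => (t' ⟨q, W q⟩).2) p := by
    intro W hW
    have h1 : MDiffAt (fun q => Ring.inverse (L ∘L A q) (L (t ⟨f q, mfderiv% f q (W q)⟩).2)) p :=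
      hinv.clm_apply (mdifferentiableAt_const.clm_apply hW)
    refine h1.congr_of_eventuallyEq ?_
    filter_upwards [hev, hunit] with q hq hqu
    rw [hq]
    exact congr($(Ring.inverse_mul_cancel _ hqu) (t' ⟨q, W q⟩).2).symm
  have hd : ∀ {W : ∀ q : M, TangentSpace 𝓘(ℝ, E') q},
      MDiffAt (fun q => (t ⟨f q, mfderiv% f q (W q)⟩).2) p →
      d% (fun q => (t ⟨f q, mfderiv% f q (W q)⟩).2) p v
        = d% A p v (t' ⟨p, W p⟩).2 + A p (d% (fun q => (t' ⟨q, W q⟩).2) p v) := by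
    intro W hW
    rw [mvfderiv_congr (hev.mono fun q hq => hq _), mvfderiv_clm_apply hA (hcoord hW)]
  have hsymm : ∀ c : E', t.symm (f p) (A p c) = mfderiv% f p (t'.symm p c) := by
    intro c
    have hs : (t' ⟨p, t'.symm p c⟩).2 = c := congr_arg Prod.snd (t'.apply_mk_symm hp' c)
    rw [← hs, ← hev.self_of_nhds, t.symm_apply_apply_mk hp, hs]
  have hadd : ∀ a b : E, t.symm (f p) (a + b) = t.symm (f p) a + t.symm (f p) b := by
    intro a b
    simp only [← t.symmL_apply (R := ℝ) hp, map_add]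
  -- The terms `dA(v)` applied to the values at `p` cancel since `W p = W' p`; the difference left
  -- is `A p` of the difference of coordinate derivatives, a tangent vector.
  refine ⟨t'.symm p (d% (fun q => (t' ⟨q, W q⟩).2) p v)
    - t'.symm p (d% (fun q => (t' ⟨q, W' q⟩).2) p v), ?_⟩
  unfold covAlong
  simp only [← ht]
  rw [hd hW, hd hW', hWW', hadd, hadd, hsymm, hsymm, map_sub]
  abel

end

/-! ### Linear algebra: the trace of the metric, and the consequences of relation (R). -/

theorem metricTrace_smul {V W : Type*} [AddCommGroup V] [Module ℝ V] [FiniteDimensional ℝ V]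
    [AddCommGroup W] [Module ℝ W] (B : LinearMap.BilinForm ℝ V) (hs : ∀ u v, B u v = B v u)
    (hB : ∀ u, (∀ v, B u v = 0) → u = 0) (c : W) :
    metricTrace (fun u v => B u v) (fun u v => B u v • c) = (finrank ℝ V : ℝ) • c := by
  set e := Module.finBasis ℝ V with he
  have hnd : B.Nondegenerate := ⟨hB, fun u hu => hB u fun v => (hs u v).trans (hu v)⟩
  have hdet := (LinearMap.BilinForm.nondegenerate_iff_det_ne_zero e).1 hnd
  have hG : (Matrix.of fun k l => B (e k) (e l)) = LinearMap.BilinForm.toMatrix e B := by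
    ext k l
    simp [LinearMap.BilinForm.toMatrix_apply]
  have hT : (LinearMap.BilinForm.toMatrix e B).transpose = LinearMap.BilinForm.toMatrix e B := by
    ext k l
    simp [LinearMap.BilinForm.toMatrix_apply, hs]
  have h1 : ∑ i, ∑ j, ((LinearMap.BilinForm.toMatrix e B)⁻¹ i j) * B (e i) (e j)
      = (finrank ℝ V : ℝ) := by
    -- The double sum is the trace of `G⁻¹ Gᵀ`, and `Gᵀ = G`.
    have h2 : ((LinearMap.BilinForm.toMatrix e B)⁻¹
        * (LinearMap.BilinForm.toMatrix e B).transpose).trace = (finrank ℝ V : ℝ) := by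
      rw [hT, Matrix.nonsing_inv_mul _ (isUnit_iff_ne_zero.2 hdet), Matrix.trace_one]
      simp
    rw [← h2]
    simp [Matrix.trace, Matrix.mul_apply, LinearMap.BilinForm.toMatrix_apply]
  unfold metricTrace
  simp only [← he, hG, smul_smul]
  rw [← h1, Finset.sum_smul]
  simp only [Finset.sum_smul]

section Algebra
variable {T V : Type*} [AddCommGroup V] [Module ℝ V] {h : T → T → V} {g : T → T → ℝ}
  {j : Fin 3 → T → T} {J : Fin 3 → V →ₗ[ℝ] V} {A : Fin 3 → V}

/-- Invariance of `h` under `j 0`, deduced from the sign changes under `j 1` and `j 2`, is played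
against the Hermitian identity for `j 0`, which yields `2h = 2g · J 0 (A 0)`. -/
theorem eq_smul_of_complexLinear_up_to (hs : ∀ v w, h v w = h w v) (gs : ∀ v w, g v w = g w v)
    (hj : ∀ v, j 0 v = j 1 (j 2 v)) (hJ : ∀ α x, J α (J α x) = -x)
    (g0 : ∀ v w, g (j 0 v) (j 0 w) = g v w) (g1 : ∀ v w, g (j 1 v) (j 1 w) = -g v w)
    (g2 : ∀ v w, g (j 2 v) (j 2 w) = -g v w)
    (hR : ∀ α v w, h v (j α w) = J α (h v w) + g v w • A α + g v (j α w) • J α (A α)) (v w : T) :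
    h v w = g v w • J 0 (A 0) := by
  -- Apply `hR` in the second slot and, by symmetry, in the first. The multiples of `A α` cancel
  -- because `J α (J α (A α)) = -A α`.
  have key : ∀ α v w, h (j α v) (j α w)
      = -h v w + (g v w + g (j α v) (j α w)) • J α (A α) := by
    intro α v w
    rw [hR, hs (j α v) w, hR, hs w v, gs w v, gs w (j α v)]
    simp only [map_add, map_smul, hJ]
    module
  have h1 : ∀ v w, h (j 1 v) (j 1 w) = -h v w := fun v w => by rw [key, g1]; module
  have h2 : ∀ v w, h (j 2 v) (j 2 w) = -h v w := fun v w => by rw [key, g2]; module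
  have h0 : h (j 0 v) (j 0 w) = h v w := by rw [hj, hj, h1, h2, neg_neg]
  have h3 := key 0 v w
  rw [h0, g0] at h3
  have h4 : (2 : ℝ) • h v w = (2 : ℝ) • g v w • J 0 (A 0) := by
    rw [two_smul]
    nth_rewrite 2 [h3]
    module
  exact smul_right_injective V (two_ne_zero (α := ℝ)) h4

/-- With `h = g · B`, relation `hR` says that `B - J α (A α)` is scaled by a real number under `J
α`. As `J α` squares to `-1`, it has no real eigenvalue. -/
theorem eq_of_smul_complexLinear_up_to {B : V} (hJ : ∀ α x, J α (J α x) = -x)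
    (hh : ∀ v w, h v w = g v w • B)
    (hR : ∀ α v w, h v (j α w) = J α (h v w) + g v w • A α + g v (j α w) • J α (A α))
    {v w : T} (hvw : g v w = 1) (α : Fin 3) : B = J α (A α) := by
  have h1 := hR α v w
  rw [hh, hh, hvw, one_smul, one_smul] at h1
  set a := g v (j α w)
  set D := B - J α (A α) with hD
  have h2 : a • D = J α D := by
    rw [hD, smul_sub, h1, map_sub, hJ]
    module
  have h3 : a • J α D = -D := by rw [← map_smul, h2, hJ]
  have h4 : (a * a + 1) • D = 0 := by
    rw [add_smul, mul_smul, h2, h3]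
    simp
  rcases smul_eq_zero.1 h4 with h5 | h5
  · nlinarith [mul_self_nonneg a]
  · exact sub_eq_zero.1 h5

end Algebra

/-! ### Tangent and normal parts, and how `h` interacts with `J_α`. -/

namespace AlmostHypercomplexHN
variable {E : Type*} [NormedAddCommGroup E] [NormedSpace ℝ E] [FiniteDimensional ℝ E]
  {N : Type*} [TopologicalSpace N] [ChartedSpace E N] [IsManifold 𝓘(ℝ, E) ∞ N]
  {E' : Type*} [NormedAddCommGroup E'] [NormedSpace ℝ E'] [FiniteDimensional ℝ E']
  {M : Type*} [TopologicalSpace M] [ChartedSpace E' M] [IsManifold 𝓘(ℝ, E') ∞ M]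
  {S : AlmostHypercomplexHN (E := E) N} {f : M → N}

/-- `g(J u, J v) = ε g(u, v)` with `ε = 1` in the Hermitian and `ε = -1` in the Norden case. -/
def compatSign (α : Fin 3) : ℝ := if α = 0 then 1 else -1

theorem g_J_J (α : Fin 3) (x : N) (u v : TangentSpace 𝓘(ℝ, E) x) :
    S.g x (S.J α x u) (S.J α x v) = compatSign α * S.g x u v := by
  fin_cases α
  · simpa [compatSign] using S.hermitian x u v
  · simpa [compatSign] using S.norden₂ x u v
  · simpa [compatSign] using S.norden₃ x u v

theorem g_J_left (α : Fin 3) (x : N) (u v : TangentSpace 𝓘(ℝ, E) x) :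
    S.g x (S.J α x u) v = -compatSign α * S.g x u (S.J α x v) := by
  have h := S.g_J_J α x u (S.J α x v)
  rw [S.J_sq, map_neg] at h
  linarith

theorem lee_add (cov : CovariantDerivative 𝓘(ℝ, E) E (TangentSpace 𝓘(ℝ, E) : N → Type _))
    (α : Fin 3) (x : N) (w w' : TangentSpace 𝓘(ℝ, E) x) :
    S.lee cov α x (w + w') = S.lee cov α x w + S.lee cov α x w' := by
  simp [lee, metricTrace, F, mul_add, Finset.sum_add_distrib]

theorem lee_smul (cov : CovariantDerivative 𝓘(ℝ, E) E (TangentSpace 𝓘(ℝ, E) : N → Type _))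
    (α : Fin 3) (x : N) (c : ℝ) (w : TangentSpace 𝓘(ℝ, E) x) :
    S.lee cov α x (c • w) = c * S.lee cov α x w := by
  simp [lee, metricTrace, F, Finset.mul_sum, mul_left_comm]

variable (S) in
/-- Every linear form on a tangent space is represented by a vector with respect to `g`. -/
theorem exists_g_eq (x : N) (l : TangentSpace 𝓘(ℝ, E) x →ₗ[ℝ] ℝ) :
    ∃ a : TangentSpace 𝓘(ℝ, E) x, ∀ w, S.g x a w = l w := by
  let B : TangentSpace 𝓘(ℝ, E) x →ₗ[ℝ] Module.Dual ℝ (TangentSpace 𝓘(ℝ, E) x) :=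
    LinearMap.mk₂ ℝ (fun u v => S.g x u v) (by simp) (by simp) (by simp) (by simp)
  have hB : Function.Injective B := by
    rw [← LinearMap.ker_eq_bot, LinearMap.ker_eq_bot']
    exact fun u hu => S.g_nondeg x u fun v => congr($hu v)
  have hs : Function.Surjective B :=
    (LinearMap.injective_iff_surjective_of_finrank_eq_finrank
      Subspace.dual_finrank_eq.symm).1 hB
  obtain ⟨a, ha⟩ := hs l
  exact ⟨a, fun w => congr($ha w)⟩

namespace IsHolomorphicSubmanifold
variable (hM : S.IsHolomorphicSubmanifold (E' := E') f)

theorem mfderiv_injective (hM : S.IsHolomorphicSubmanifold (E' := E') f)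
    (p : M) : Function.Injective (mfderiv 𝓘(ℝ, E') 𝓘(ℝ, E) f p) := by
  intro v w hvw
  rw [← sub_eq_zero]
  refine hM.nondeg p _ fun u => ?_
  rw [inducedMetric, map_sub, hvw, sub_self]
  simp

theorem normalPart_mem (p : M) (u : TangentSpace 𝓘(ℝ, E) (f p)) :
    hM.normalPart p u ∈ S.normalSub (E' := E') f p :=
  Submodule.projection_apply_mem (hM.isCompl p) u

theorem normalPart_of_mem {p : M} {u : TangentSpace 𝓘(ℝ, E) (f p)}
    (hu : u ∈ S.normalSub (E' := E') f p) : hM.normalPart p u = u :=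
  Submodule.projection_apply_of_mem_left (hM.isCompl p) hu

theorem normalPart_mfderiv (p : M) (v : TangentSpace 𝓘(ℝ, E') p) :
    hM.normalPart p (mfderiv% f p v) = 0 :=
  Submodule.projection_apply_of_mem_right (hM.isCompl p) ⟨v, rfl⟩

theorem exists_eq_mfderiv_add_normalPart (p : M) (u : TangentSpace 𝓘(ℝ, E) (f p)) :
    ∃ v : TangentSpace 𝓘(ℝ, E') p, u = mfderiv% f p v + hM.normalPart p u := by
  obtain ⟨v, hv⟩ := Submodule.sub_projection_mem (hM.isCompl p) u
  refine ⟨v, ?_⟩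
  change mfderiv% f p v = u - hM.normalPart p u at hv
  rw [hv, sub_add_cancel]

theorem g_mfderiv_normal {p : M} {ν : TangentSpace 𝓘(ℝ, E) (f p)}
    (hν : ν ∈ S.normalSub (E' := E') f p) (v : TangentSpace 𝓘(ℝ, E') p) :
    S.g (f p) (mfderiv% f p v) ν = 0 := hν _ ⟨v, rfl⟩

theorem g_normalPart {p : M} (u : TangentSpace 𝓘(ℝ, E) (f p)) {ν : TangentSpace 𝓘(ℝ, E) (f p)}
    (hν : ν ∈ S.normalSub (E' := E') f p) :
    S.g (f p) (hM.normalPart p u) ν = S.g (f p) u ν := by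
  obtain ⟨v, hv⟩ := hM.exists_eq_mfderiv_add_normalPart p u
  nth_rewrite 2 [hv]
  rw [map_add, add_apply, g_mfderiv_normal hν, zero_add]

theorem eq_zero_of_mem_normalSub (hM : S.IsHolomorphicSubmanifold (E' := E') f)
    {p : M} {u : TangentSpace 𝓘(ℝ, E) (f p)}
    (hu : u ∈ S.normalSub (E' := E') f p)
    (h : ∀ ν ∈ S.normalSub (E' := E') f p, S.g (f p) u ν = 0) : u = 0 := by
  refine S.g_nondeg (f p) u fun w => ?_
  obtain ⟨v, hv⟩ := hM.exists_eq_mfderiv_add_normalPart p w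
  rw [hv, map_add, S.g_symm, g_mfderiv_normal hu, h _ (hM.normalPart_mem p w), zero_add]

theorem exists_mfderiv_eq_J (hM : S.IsHolomorphicSubmanifold (E' := E') f)
    (α : Fin 3) (p : M) (v : TangentSpace 𝓘(ℝ, E') p) :
    ∃ w : TangentSpace 𝓘(ℝ, E') p, mfderiv% f p w = S.J α (f p) (mfderiv% f p v) := by
  have h : S.J α (f p) (mfderiv% f p v) ∈ tangentSub (E := E) (E' := E') f p := by
    rw [← hM.holomorphic α p]
    exact ⟨_, ⟨v, rfl⟩, rfl⟩
  exact h

/-- The almost complex structure induced on the submanifold. -/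
def tangentJ (α : Fin 3) (p : M) (v : TangentSpace 𝓘(ℝ, E') p) : TangentSpace 𝓘(ℝ, E') p :=
  (hM.exists_mfderiv_eq_J α p v).choose

theorem mfderiv_tangentJ (α : Fin 3) (p : M) (v : TangentSpace 𝓘(ℝ, E') p) :
    mfderiv% f p (hM.tangentJ α p v) = S.J α (f p) (mfderiv% f p v) :=
  (hM.exists_mfderiv_eq_J α p v).choose_spec

/-- `J_α` preserves `g` up to sign and preserves the tangent space, hence also its orthogonal
complement. -/
theorem J_mem_normalSub (hM : S.IsHolomorphicSubmanifold (E' := E') f)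
    (α : Fin 3) {p : M} {ν : TangentSpace 𝓘(ℝ, E) (f p)}
    (hν : ν ∈ S.normalSub (E' := E') f p) : S.J α (f p) ν ∈ S.normalSub (E' := E') f p := by
  rintro _ ⟨v, rfl⟩
  have h := S.g_J_J α (f p) (mfderiv% f p (hM.tangentJ α p v)) ν
  rw [g_mfderiv_normal hν, hM.mfderiv_tangentJ, S.J_sq, map_neg, neg_apply, mul_zero,
    neg_eq_zero] at h
  exact h

theorem normalPart_J (α : Fin 3) (p : M) (u : TangentSpace 𝓘(ℝ, E) (f p)) :
    hM.normalPart p (S.J α (f p) u) = S.J α (f p) (hM.normalPart p u) := by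
  obtain ⟨v, hv⟩ := hM.exists_eq_mfderiv_add_normalPart p u
  nth_rewrite 1 [hv]
  rw [map_add, map_add, ← hM.mfderiv_tangentJ, hM.normalPart_mfderiv, zero_add,
    hM.normalPart_of_mem (hM.J_mem_normalSub α (hM.normalPart_mem p u))]

variable {cov : CovariantDerivative 𝓘(ℝ, E) E (TangentSpace 𝓘(ℝ, E) : N → Type _)}

theorem secondFundamentalForm_symm (hcov : cov.torsion = 0) (p : M)
    (v w : TangentSpace 𝓘(ℝ, E') p) :
    hM.secondFundamentalForm cov p v w = hM.secondFundamentalForm cov p w v := by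
  unfold secondFundamentalForm
  rw [covAlong_mfderiv_extend_symm hcov hM.isImmersion.contMDiff]

/-- The normal part of the Leibniz rule for `J_α W`, using that `J_α` commutes with the normal
projection. -/
theorem secondFundamentalForm_tangentJ (α : Fin 3) (p : M) (v w : TangentSpace 𝓘(ℝ, E') p) :
    hM.secondFundamentalForm cov p v (hM.tangentJ α p w)
      = S.J α (f p) (hM.secondFundamentalForm cov p v w)
        + hM.normalPart p (S.covJ cov α (f p) (mfderiv% f p w) (mfderiv% f p v)) := by
  have hf := hM.isImmersion.contMDiff
  have hfd : MDiffAt f p := hf.mdifferentiable (by simp) p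
  have hY := mdifferentiableAt_mfderiv_extend hf (p := p) w
  -- `tangentJ` is chosen pointwise, so its regularity in `q` is not immediate; the pushforward,
  -- however, is `J_α` of a differentiable field along `f`. This is the form of regularity that
  -- `exists_covAlong_mfderiv_sub` asks for.
  have hJY : MDiffAt (fun q => (trivializationAt E (TangentSpace 𝓘(ℝ, E) : N → Type _) (f p)
        ⟨f q, mfderiv% f q (hM.tangentJ α q (extend E' w q))⟩).2) p := by
    obtain ⟨K, hK, hJK⟩ := S.exists_J_inCoordinates α (f p)
    refine ((hK.comp p hfd).clm_apply hY).congr_of_eventuallyEq ?_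
    filter_upwards [hfd.continuousAt.eventually hJK] with q hq
    rw [hM.mfderiv_tangentJ]
    exact hq _
  obtain ⟨u, hu⟩ := exists_covAlong_mfderiv_sub cov hf (hM.mfderiv_injective p) hJY
    (mdifferentiableAt_mfderiv_extend hf (hM.tangentJ α p w)) (by simp) v
  have h1 := S.covAlong_J cov α hfd hY v
  have h2 : (fun q => mfderiv% f q (hM.tangentJ α q (extend E' w q)))
      = fun q => S.J α (f q) (mfderiv% f q (extend E' w q)) :=
    funext fun q => hM.mfderiv_tangentJ α q _
  rw [h2, h1] at hu
  unfold secondFundamentalForm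
  have h3 := congr_arg (hM.normalPart p) hu
  rw [map_add, map_add, hM.normalPart_mfderiv, add_zero, hM.normalPart_J] at h3
  rw [← h3, add_comm]
  simp only [extend_apply_self]

end IsHolomorphicSubmanifold
end AlmostHypercomplexHN

/-! ### The class `𝒲`: relation (R) and the mean curvature vector. -/

namespace AlmostHypercomplexHN
variable {E : Type*} [NormedAddCommGroup E] [NormedSpace ℝ E] [FiniteDimensional ℝ E]
  {N : Type*} [TopologicalSpace N] [ChartedSpace E N] [IsManifold 𝓘(ℝ, E) ∞ N]
  {E' : Type*} [NormedAddCommGroup E'] [NormedSpace ℝ E'] [FiniteDimensional ℝ E']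
  {M : Type*} [TopologicalSpace M] [ChartedSpace E' M] [IsManifold 𝓘(ℝ, E') ∞ M]
  {S : AlmostHypercomplexHN (E := E) N} {f : M → N}
  {cov : CovariantDerivative 𝓘(ℝ, E) E (TangentSpace 𝓘(ℝ, E) : N → Type _)}

/-- The constants in the defining identities of the class `𝒲`. -/
def structureConstant (n : ℕ) (α : Fin 3) : ℝ :=
  if α = 0 then 1 / (2 * (2 * (n : ℝ) - 1)) else 1 / (4 * (n : ℝ))

theorem structureConstant_ne_zero {n : ℕ} (hn : 0 < n) (α : Fin 3) :
    structureConstant n α ≠ 0 := by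
  have h : (1 : ℝ) ≤ n := by exact_mod_cast hn
  unfold structureConstant
  split_ifs
  · exact one_div_ne_zero (by linarith)
  · exact one_div_ne_zero (by linarith)

namespace IsHolomorphicSubmanifold
variable (hM : S.IsHolomorphicSubmanifold (E' := E') f)

theorem tangentJ_cyclic (p : M) (v : TangentSpace 𝓘(ℝ, E') p) :
    hM.tangentJ 0 p v = hM.tangentJ 1 p (hM.tangentJ 2 p v) := by
  refine hM.mfderiv_injective p ?_
  simp only [hM.mfderiv_tangentJ]
  exact S.J_cyclic 0 _ _

theorem inducedMetric_tangentJ (α : Fin 3) (p : M) (v w : TangentSpace 𝓘(ℝ, E') p) :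
    S.inducedMetric f p (hM.tangentJ α p v) (hM.tangentJ α p w)
      = compatSign α * S.inducedMetric f p v w := by
  simp only [inducedMetric, hM.mfderiv_tangentJ, S.g_J_J]

/-- The fundamental tensor of a `𝒲`-manifold on two tangent vectors and one normal vector. -/
theorem F_mfderiv_mfderiv_normal {n : ℕ} (hW : S.IsWManifold cov n) (α : Fin 3) {p : M}
    (v w : TangentSpace 𝓘(ℝ, E') p) {ν : TangentSpace 𝓘(ℝ, E) (f p)}
    (hν : ν ∈ S.normalSub (E' := E') f p) :
    S.F cov α (f p) (mfderiv% f p v) (mfderiv% f p w) ν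
      = structureConstant n α * (S.inducedMetric f p v w * S.lee cov α (f p) ν
        - compatSign α * S.inducedMetric f p v (hM.tangentJ α p w)
          * S.lee cov α (f p) (S.J α (f p) ν)) := by
  -- These kill the two terms pairing `v` with `ν` and with `J_α ν`. The sign of the surviving `J_α`
  -- term is minus in the Hermitian case and plus in the Norden case, that is, `-compatSign α`.
  have h1 := g_mfderiv_normal hν v
  have h2 := g_mfderiv_normal (hM.J_mem_normalSub α hν) v
  by_cases hα : α = 0
  · subst hα
    rw [hW.F_one, h1, h2]
    simp [inducedMetric, structureConstant, compatSign, hM.mfderiv_tangentJ]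
  · rw [hW.F_two_three α hα, h1, h2]
    simp [inducedMetric, structureConstant, compatSign, hα, hM.mfderiv_tangentJ]

theorem exists_normal_lee (hM : S.IsHolomorphicSubmanifold (E' := E') f)
    (n : ℕ) (α : Fin 3) (p : M) :
    ∃ a ∈ S.normalSub (E' := E') f p, ∀ ν ∈ S.normalSub (E' := E') f p,
      S.g (f p) a ν = structureConstant n α * S.lee cov α (f p) ν := by
  obtain ⟨a, ha⟩ := S.exists_g_eq (f p)
    { toFun := fun w => structureConstant n α * S.lee cov α (f p) w
      map_add' := fun w w' => by rw [lee_add, mul_add]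
      map_smul' := fun c w => by rw [lee_smul, RingHom.id_apply, smul_eq_mul, mul_left_comm] }
  exact ⟨hM.normalPart p a, hM.normalPart_mem p a, fun ν hν => by rw [hM.g_normalPart a hν, ha]; rfl⟩

/-- The normal vector representing a multiple of the restriction of the Lee form to the normal
space. -/
def leeNormal (cov : CovariantDerivative 𝓘(ℝ, E) E (TangentSpace 𝓘(ℝ, E) : N → Type _))
    (n : ℕ) (p : M) (α : Fin 3) : TangentSpace 𝓘(ℝ, E) (f p) :=
  (hM.exists_normal_lee (cov := cov) n α p).choose

theorem leeNormal_mem (n : ℕ) (p : M) (α : Fin 3) :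
    hM.leeNormal cov n p α ∈ S.normalSub (E' := E') f p :=
  (hM.exists_normal_lee (cov := cov) n α p).choose_spec.1

theorem g_leeNormal (n : ℕ) (p : M) (α : Fin 3) {ν : TangentSpace 𝓘(ℝ, E) (f p)}
    (hν : ν ∈ S.normalSub (E' := E') f p) :
    S.g (f p) (hM.leeNormal cov n p α) ν = structureConstant n α * S.lee cov α (f p) ν :=
  (hM.exists_normal_lee (cov := cov) n α p).choose_spec.2 ν hν

/-- `g` is non-degenerate on the normal space and the structure constant is non-zero, so duality
loses nothing. -/
theorem leeNormal_eq_zero_iff {n : ℕ} (hn : 0 < n) (p : M) (α : Fin 3) :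
    hM.leeNormal cov n p α = 0 ↔
      ∀ ν ∈ S.normalSub (E' := E') f p, S.lee cov α (f p) ν = 0 := by
  constructor
  · intro h ν hν
    have h1 := hM.g_leeNormal (cov := cov) n p α hν
    rw [h, map_zero, zero_apply] at h1
    exact (mul_eq_zero.1 h1.symm).resolve_left (structureConstant_ne_zero hn α)
  · intro h
    refine hM.eq_zero_of_mem_normalSub (hM.leeNormal_mem n p α) fun ν hν => ?_
    rw [hM.g_leeNormal n p α hν, h ν hν, mul_zero]

/-- Both sides are normal, so it suffices to pair with normal `ν`. Moving `J_α` across `g` costs the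
factor `-compatSign α`, which matches the sign in `F_α`. -/
theorem normalPart_covJ {n : ℕ} (hW : S.IsWManifold cov n) (α : Fin 3) (p : M)
    (v w : TangentSpace 𝓘(ℝ, E') p) :
    hM.normalPart p (S.covJ cov α (f p) (mfderiv% f p w) (mfderiv% f p v))
      = S.inducedMetric f p v w • hM.leeNormal cov n p α
        + S.inducedMetric f p v (hM.tangentJ α p w) • S.J α (f p) (hM.leeNormal cov n p α) := by
  have hA := hM.leeNormal_mem (cov := cov) n p α
  rw [← sub_eq_zero]
  refine hM.eq_zero_of_mem_normalSub (sub_mem (hM.normalPart_mem p _) (add_mem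
    (Submodule.smul_mem _ _ hA) (Submodule.smul_mem _ _ (hM.J_mem_normalSub α hA)))) fun ν hν => ?_
  have h1 := hM.F_mfderiv_mfderiv_normal hW α v w hν
  have h2 := hM.g_normalPart (S.covJ cov α (f p) (mfderiv% f p w) (mfderiv% f p v)) hν
  simp only [map_sub, map_add, map_smul, sub_apply, add_apply, smul_apply, smul_eq_mul]
  rw [h2, hM.g_leeNormal n p α hν, S.g_J_left, hM.g_leeNormal n p α (hM.J_mem_normalSub α hν)]
  rw [F] at h1
  rw [h1]
  ring

theorem secondFundamentalForm_tangentJ_of_isWManifold {n : ℕ} (hW : S.IsWManifold cov n)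
    (α : Fin 3) (p : M) (v w : TangentSpace 𝓘(ℝ, E') p) :
    hM.secondFundamentalForm cov p v (hM.tangentJ α p w)
      = S.J α (f p) (hM.secondFundamentalForm cov p v w)
        + S.inducedMetric f p v w • hM.leeNormal cov n p α
        + S.inducedMetric f p v (hM.tangentJ α p w) • S.J α (f p) (hM.leeNormal cov n p α) := by
  rw [hM.secondFundamentalForm_tangentJ, hM.normalPart_covJ hW, add_assoc]

theorem inducedMetric_symm (p : M) (v w : TangentSpace 𝓘(ℝ, E') p) :
    S.inducedMetric f p v w = S.inducedMetric f p w v := S.g_symm _ _ _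

theorem secondFundamentalForm_eq_smul {n : ℕ} (hcov : cov.torsion = 0) (hW : S.IsWManifold cov n)
    (p : M) (v w : TangentSpace 𝓘(ℝ, E') p) :
    hM.secondFundamentalForm cov p v w
      = S.inducedMetric f p v w • S.J 0 (f p) (hM.leeNormal cov n p 0) :=
  eq_smul_of_complexLinear_up_to (j := fun α => hM.tangentJ α p)
    (J := fun α => (S.J α (f p)).toLinearMap) (A := hM.leeNormal cov n p)
    (hM.secondFundamentalForm_symm hcov p) (inducedMetric_symm p) (hM.tangentJ_cyclic p)
    (fun α => S.J_sq α (f p))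
    (fun v w => by simp [hM.inducedMetric_tangentJ, compatSign])
    (fun v w => by simp [hM.inducedMetric_tangentJ, compatSign])
    (fun v w => by simp [hM.inducedMetric_tangentJ, compatSign])
    (fun α => hM.secondFundamentalForm_tangentJ_of_isWManifold hW α p) v w

theorem meanCurvature_eq {n : ℕ} (hE' : 0 < finrank ℝ E') (hcov : cov.torsion = 0)
    (hW : S.IsWManifold cov n) (p : M) :
    hM.meanCurvature cov p = S.J 0 (f p) (hM.leeNormal cov n p 0) := by
  let B : LinearMap.BilinForm ℝ (TangentSpace 𝓘(ℝ, E') p) :=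
    LinearMap.mk₂ ℝ (S.inducedMetric f p) (by simp [inducedMetric]) (by simp [inducedMetric])
      (by simp [inducedMetric]) (by simp [inducedMetric])
  have h1 : hM.secondFundamentalForm cov p
      = fun v w => B v w • S.J 0 (f p) (hM.leeNormal cov n p 0) := by
    ext v w
    exact hM.secondFundamentalForm_eq_smul hcov hW p v w
  have h2 := metricTrace_smul B (inducedMetric_symm p) (hM.nondeg p)
    (S.J 0 (f p) (hM.leeNormal cov n p 0))
  have h3 : (finrank ℝ (TangentSpace 𝓘(ℝ, E') p) : ℝ) = finrank ℝ E' := rfl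
  have h4 : (finrank ℝ E' : ℝ) ≠ 0 := by exact_mod_cast hE'.ne'
  unfold meanCurvature
  rw [h1]
  rw [h3] at h2
  refine (congr_arg _ h2).trans ?_
  rw [smul_smul, one_div_mul_cancel h4, one_smul]

theorem exists_inducedMetric_eq_one (hM : S.IsHolomorphicSubmanifold (E' := E') f)
    (hE' : 0 < finrank ℝ E') (p : M) :
    ∃ v w : TangentSpace 𝓘(ℝ, E') p, S.inducedMetric f p v w = 1 := by
  have : Nontrivial E' := Module.nontrivial_of_finrank_pos hE'
  obtain ⟨v, hv⟩ := exists_ne (0 : E')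
  have h1 : ¬ ∀ w : TangentSpace 𝓘(ℝ, E') p, S.inducedMetric f p v w = 0 :=
    fun h => hv (hM.nondeg p v h)
  push Not at h1
  obtain ⟨w, hw⟩ := h1
  refine ⟨v, (S.inducedMetric f p v w)⁻¹ • w, ?_⟩
  have h2 : S.inducedMetric f p v ((S.inducedMetric f p v w)⁻¹ • w)
      = (S.inducedMetric f p v w)⁻¹ * S.inducedMetric f p v w := by
    simp [inducedMetric]
  rw [h2, inv_mul_cancel₀ hw]

/-- This ties the three Lee forms together: one vector `C` determines all three normal restrictions.
-/
theorem meanCurvature_eq_J_leeNormal {n : ℕ} (hE' : 0 < finrank ℝ E') (hcov : cov.torsion = 0)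
    (hW : S.IsWManifold cov n) (p : M) (α : Fin 3) :
    hM.meanCurvature cov p = S.J α (f p) (hM.leeNormal cov n p α) := by
  rw [hM.meanCurvature_eq hE' hcov hW]
  obtain ⟨v, w, hvw⟩ := hM.exists_inducedMetric_eq_one hE' p
  exact eq_of_smul_complexLinear_up_to (j := fun α => hM.tangentJ α p)
    (J := fun α => (S.J α (f p)).toLinearMap) (A := hM.leeNormal cov n p)
    (fun α => S.J_sq α (f p)) (hM.secondFundamentalForm_eq_smul hcov hW p)
    (fun α => hM.secondFundamentalForm_tangentJ_of_isWManifold hW α p) hvw α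

theorem meanCurvature_eq_zero_iff {n : ℕ} (hn : 0 < n) (hE' : 0 < finrank ℝ E')
    (hcov : cov.torsion = 0) (hW : S.IsWManifold cov n) (p : M) (α : Fin 3) :
    hM.meanCurvature cov p = 0 ↔
      ∀ ν ∈ S.normalSub (E' := E') f p, S.lee cov α (f p) ν = 0 := by
  rw [← hM.leeNormal_eq_zero_iff hn, hM.meanCurvature_eq_J_leeNormal hE' hcov hW p α]
  constructor
  · intro h
    have h1 := S.J_sq α (f p) (hM.leeNormal cov n p α)
    rw [h, map_zero, eq_comm, neg_eq_zero] at h1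
    exact h1
  · intro h
    rw [h, map_zero]

end IsHolomorphicSubmanifold
end AlmostHypercomplexHN

end HermitianNorden

end

/-! ### The theorem, read off from the pointwise criterion for `C = 0`. -/

theorem theorem3p3
    {E : Type*} [NormedAddCommGroup E] [NormedSpace ℝ E] [FiniteDimensional ℝ E]
    {N : Type*} [TopologicalSpace N] [ChartedSpace E N] [IsManifold 𝓘(ℝ, E) ∞ N]
    {E' : Type*} [NormedAddCommGroup E'] [NormedSpace ℝ E'] [FiniteDimensional ℝ E']
    {M : Type*} [TopologicalSpace M] [ChartedSpace E' M] [IsManifold 𝓘(ℝ, E') ∞ M]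
    {m n : ℕ} (hm : 0 < m) (hmn : m < n)
    (hE' : Module.finrank ℝ E' = 4 * m) (hE : Module.finrank ℝ E = 4 * n)
    (S : HermitianNorden.AlmostHypercomplexHN (E := E) N)
    (cov : CovariantDerivative 𝓘(ℝ, E) E (TangentSpace 𝓘(ℝ, E) : N → Type _))
    (hcov : S.IsLeviCivita cov) (hW : S.IsWManifold cov n)
    (f : M → N) (hM : S.IsHolomorphicSubmanifold (E' := E') f) :
    -- `h(v, w) = g(v, w) C`
    (∀ (p : M) (v w : TangentSpace 𝓘(ℝ, E') p),
      hM.secondFundamentalForm cov p v w = S.inducedMetric f p v w • hM.meanCurvature cov p) ∧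
    -- pointwise: `C ≠ 0` (resp. `C = 0`) iff all Lee forms are non-zero (resp. vanish) on `T_p M^⊥`
    (∀ p : M,
      (hM.meanCurvature cov p ≠ 0 ↔
        ∀ α : Fin 3, ∃ ν ∈ S.normalSub (E' := E') f p, S.lee cov α (f p) ν ≠ 0) ∧
      (hM.meanCurvature cov p = 0 ↔
        ∀ α : Fin 3, ∀ ν ∈ S.normalSub (E' := E') f p, S.lee cov α (f p) ν = 0)) ∧
    -- totally umbilical iff all Lee forms are non-zero on `TM^⊥`
    (hM.IsTotallyUmbilical cov ↔
      ∀ α : Fin 3, ∃ p : M, ∃ ν ∈ S.normalSub (E' := E') f p, S.lee cov α (f p) ν ≠ 0) ∧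
    -- totally geodesic iff all Lee forms vanish on `TM^⊥`
    (hM.IsTotallyGeodesic cov ↔
      ∀ α : Fin 3, ∀ p : M, ∀ ν ∈ S.normalSub (E' := E') f p, S.lee cov α (f p) ν = 0) := by
  have hn : 0 < n := hm.trans hmn
  have hE'pos : 0 < Module.finrank ℝ E' := by omega
  have hh : ∀ (p : M) (v w : TangentSpace 𝓘(ℝ, E') p),
      hM.secondFundamentalForm cov p v w = S.inducedMetric f p v w • hM.meanCurvature cov p :=
    fun p v w => by
      rw [hM.meanCurvature_eq hE'pos hcov.1 hW p, hM.secondFundamentalForm_eq_smul hcov.1 hW]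
  have hC := hM.meanCurvature_eq_zero_iff hn hE'pos hcov.1 hW
  have hC' : ∀ (p : M) (α : Fin 3), hM.meanCurvature cov p ≠ 0 ↔
      ∃ ν ∈ S.normalSub (E' := E') f p, S.lee cov α (f p) ν ≠ 0 := fun p α => by
    rw [Ne, hC p α]
    push Not
    rfl
  refine ⟨hh, fun p => ⟨?_, ?_⟩, ?_, ?_⟩
  · exact ⟨fun h α => (hC' p α).1 h, fun h => (hC' p 0).2 (h 0)⟩
  · exact ⟨fun h α => (hC p α).1 h, fun h => (hC p 0).2 (h 0)⟩
  · constructor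
    · rintro ⟨-, p, hp⟩ α
      exact ⟨p, (hC' p α).1 hp⟩
    · intro h
      -- The points given for different `α` may differ; one Lee form already forces `C ≠ 0` at its
      -- own point.
      obtain ⟨p, hp⟩ := h 0
      exact ⟨hh, p, (hC' p 0).2 hp⟩
  · constructor
    · intro h α p
      refine (hC p α).1 ?_
      -- For a pair with `g(v,w) = 1`, `C` is the value `h(v,w)`, which is zero.
      obtain ⟨v, w, hvw⟩ := hM.exists_inducedMetric_eq_one hE'pos p
      rw [← one_smul ℝ (hM.meanCurvature cov p), ← hvw, ← hh]
      exact h p v w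
    · intro h p v w
      rw [hh, (hC p 0).2 (h 0 p), smul_zero]
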